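/- Let $\tau\in\mathbb C$ and $q=e^{i\pi\tau}$ with $|q|<1$; write $q^{2/5}=e^{2i\pi\tau/5}$. The Rogers–Ramanujan continued fraction $$R(q)=\cfrac{q^{2/5}}{1+\cfrac{q^2}{1+\cfrac{q^4}{1+\cfrac{q^6}{1+\cdots}}}}$$ (the limit of its convergents) converges. If $$\Big|\sin\tfrac{\pi\tau}{2}\Big|<\big|\sin\big((k+\tfrac12)5\pi\tau\big)\big|\quad\text{and}\quad\Big|\sin\tfrac{3\pi\tau}{2}\Big|<\big|\sin\big((k+\tfrac12)5\pi\tau\big)\big|\qquad\text{for all } k\ge 0,$$ then the double series below converges absolutely and $$R(q)=q^{2/5}\exp\Bigg(\sum_{p\ge1,\,k\ge0}\frac1p\,\frac{\big(\sin\frac{\pi\tau}{2}\big)^{2p}-\big(\sin\frac{3\pi\tau}{2}\big)^{2p}}{\big(\sin((k+\frac12)5\pi\tau)\big)^{2p}}\Bigg).$$ Moreover, for every such $q$ (without the condition on the sines), the following infinite product converges and the Rogers formula $$R(q)=q^{2/5}\prod_{k\ge1}\frac{(1-q^{10k-2})(1-q^{10k-8})}{(1-q^{10k-4})(1-q^{10k-6})}$$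 holds. -/

import Mathlib

noncomputable section

/-- The nome `q = e^{iπτ}`. -/
def nome (τ : ℂ) : ℂ := Complex.exp (Complex.I * Real.pi * τ)

/-- The power `q^{2/5}` of `q = e^{iπτ}`, that is `e^{2iπτ/5}`. -/
def nomeTwoFifths (τ : ℂ) : ℂ := Complex.exp (2 * Complex.I * Real.pi * τ / 5)

/-- The continued fraction `q^{2/5} / (1 + q^2 / (1 + q^4 / (1 + q^6 / (1 + ...))))`,
`q = e^{iπτ}`: head term `0`, all partial denominators `1`, and partial numerators
`q^{2/5}, q^2, q^4, q^6, ...`. -/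
def rogersRamanujanFraction (τ : ℂ) : GenContFract ℂ where
  h := 0
  s := Stream'.Seq.ofStream fun n : ℕ =>
    ⟨if n = 0 then nomeTwoFifths τ else nome τ ^ (2 * n), 1⟩

/-- The Rogers-Ramanujan continued fraction `R(q)`, `q = e^{iπτ}`: the limit of the convergents. -/
def rogersRamanujanR (τ : ℂ) : ℂ :=
  Filter.limUnder Filter.atTop fun n : ℕ => (rogersRamanujanFraction τ).convs n

/-- The `(p, k)` term, `p ≥ 1`, `k ≥ 0`, of the double series in the exponential expansion. -/
def expansionTerm (τ : ℂ) (p k : ℕ) : ℂ :=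
  (1 / (p : ℂ)) *
    ((Complex.sin (Real.pi * τ / 2) ^ (2 * p) - Complex.sin (3 * Real.pi * τ / 2) ^ (2 * p)) /
      Complex.sin (((k : ℂ) + 1 / 2) * 5 * Real.pi * τ) ^ (2 * p))

/-- The factor with index `k + 1`, `k ≥ 0`, of the Rogers product: the exponents
`10 (k + 1) - 2`, `10 (k + 1) - 8`, `10 (k + 1) - 4`, `10 (k + 1) - 6` are written out. -/
def rogersFactor (q : ℂ) (k : ℕ) : ℂ :=
  ((1 - q ^ (10 * k + 8)) * (1 - q ^ (10 * k + 2))) /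
    ((1 - q ^ (10 * k + 6)) * (1 - q ^ (10 * k + 4)))

end

open Filter Topology Finset

/-! Put `x = q ^ 2`. Numerators and denominators of the convergents both solve `u (n + 2) = u (n +
1) + x ^ (n + 1) * u n`. The Rogers-Selberg series `F m` solve the adjoint recurrence `F m = F (m +
1) + x ^ (m + 1) * F (m + 2)` and tend to the nonzero limit `eulerProduct x`. Pairing the two
recurrences gives a quantity independent of `n`, which determines the limit of `u`
(`tendsto_of_dual_recurrences`); on division the convergents tend to `q^{2/5} F 1 / F 0`. Both `F 0`
and `F 1` are theta series, and the Jacobi triple product (`hasSum_jacobi_triple_product`) turns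
their quotient into the Rogers product.

For the exponential formula, `sin² A - sin² B = sin (A + B) sin (A - B)` rewrites the `k`-th Rogers
factor as `(1 - s₃² / S_k²) / (1 - s₁² / S_k²)` (`rogersFactor_eq_sin_ratio`). The sine conditions
say that both quotients have norm below 1, so the Taylor series of the logarithm applies
(`hasProd_exp_log_expansion`). -/

/-! ### Infinite products and q-factorials. -/

theorem summable_norm_mul_pow_arith {q : ℂ} (hq : ‖q‖ < 1) (c : ℂ) {a : ℕ} (ha : a ≠ 0) (b : ℕ) :
    Summable fun k : ℕ => ‖-(c * q ^ (a * k + b))‖ := by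
  have h : Summable fun k : ℕ => ‖c‖ * ‖q‖ ^ b * (‖q‖ ^ a) ^ k :=
    (summable_geometric_of_lt_one (by positivity)
      (pow_lt_one₀ (norm_nonneg q) hq ha)).mul_left _
  refine h.congr fun k => ?_
  rw [norm_neg, norm_mul, norm_pow, pow_add, pow_mul]
  ring

theorem multipliable_one_sub_mul_pow {q : ℂ} (hq : ‖q‖ < 1) (c : ℂ) {a : ℕ} (ha : a ≠ 0) (b : ℕ) :
    Multipliable fun k : ℕ => 1 - c * q ^ (a * k + b) := by
  simpa only [sub_eq_add_neg] using
    multipliable_one_add_of_summable (summable_norm_mul_pow_arith hq c ha b)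

theorem one_sub_pow_ne_zero {q : ℂ} (hq : ‖q‖ < 1) {n : ℕ} (hn : n ≠ 0) : 1 - q ^ n ≠ 0 := by
  intro h
  have h1 : ‖q ^ n‖ = 1 := by rw [← sub_eq_zero.mp h, norm_one]
  rw [norm_pow] at h1
  exact (pow_lt_one₀ (norm_nonneg q) hq hn).ne h1

theorem tprod_one_sub_pow_ne_zero {q : ℂ} (hq : ‖q‖ < 1) {a : ℕ} (ha : a ≠ 0) {b : ℕ}
    (hb : b ≠ 0) : ∏' k : ℕ, (1 - q ^ (a * k + b)) ≠ 0 := by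
  have h := tprod_one_add_ne_zero_of_summable (f := fun k : ℕ => -(1 * q ^ (a * k + b)))
    (fun k => by
      rw [one_mul, ← sub_eq_add_neg]
      exact one_sub_pow_ne_zero hq (by omega))
    (summable_norm_mul_pow_arith hq 1 ha b)
  simpa only [one_mul, ← sub_eq_add_neg] using h

/-- The finite product `(1 - x) (1 - x ^ 2) ⋯ (1 - x ^ n)`. -/
noncomputable def qFactorial (x : ℂ) (n : ℕ) : ℂ := ∏ k ∈ range n, (1 - x ^ (k + 1))

/-- The infinite product `(1 - x) (1 - x ^ 2) (1 - x ^ 3) ⋯`. -/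
noncomputable def eulerProduct (x : ℂ) : ℂ := ∏' k : ℕ, (1 - x ^ (k + 1))

theorem qFactorial_zero (x : ℂ) : qFactorial x 0 = 1 := by simp [qFactorial]

theorem qFactorial_succ (x : ℂ) (n : ℕ) :
    qFactorial x (n + 1) = qFactorial x n * (1 - x ^ (n + 1)) := prod_range_succ _ _

theorem qFactorial_ne_zero {x : ℂ} (hx : ‖x‖ < 1) (n : ℕ) : qFactorial x n ≠ 0 :=
  prod_ne_zero_iff.mpr fun _ _ => one_sub_pow_ne_zero hx (Nat.succ_ne_zero _)

theorem eulerProduct_ne_zero {x : ℂ} (hx : ‖x‖ < 1) : eulerProduct x ≠ 0 := by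
  simpa [eulerProduct] using tprod_one_sub_pow_ne_zero hx one_ne_zero one_ne_zero

theorem tendsto_qFactorial {x : ℂ} (hx : ‖x‖ < 1) :
    Tendsto (qFactorial x) atTop (𝓝 (eulerProduct x)) := by
  have h := multipliable_one_sub_mul_pow hx 1 one_ne_zero 1
  simp only [one_mul] at h
  exact h.hasProd.tendsto_prod_nat

theorem exists_norm_le_of_tendsto {u : ℕ → ℂ} {l : ℂ} (h : Tendsto u atTop (𝓝 l)) :
    ∃ C, 0 < C ∧ ∀ n, ‖u n‖ ≤ C := by
  obtain ⟨C, hC, h⟩ := (Metric.isBounded_range_of_tendsto u h).exists_pos_norm_le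
  exact ⟨C, hC, fun n => h _ ⟨n, rfl⟩⟩

theorem exists_norm_qFactorial_le {x : ℂ} (hx : ‖x‖ < 1) :
    ∃ C, 0 < C ∧ ∀ n, ‖qFactorial x n‖ ≤ C :=
  exists_norm_le_of_tendsto (tendsto_qFactorial hx)

theorem exists_norm_qFactorial_inv_le {x : ℂ} (hx : ‖x‖ < 1) :
    ∃ C, 0 < C ∧ ∀ n, ‖(qFactorial x n)⁻¹‖ ≤ C :=
  exists_norm_le_of_tendsto ((tendsto_qFactorial hx).inv₀ (eulerProduct_ne_zero hx))

/-- The reciprocal of `qFactorial`, extended by zero to negative integers. -/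
noncomputable def qFactorialInv (x : ℂ) (n : ℤ) : ℂ := if n < 0 then 0 else (qFactorial x n.toNat)⁻¹

theorem qFactorialInv_of_neg (x : ℂ) {n : ℤ} (hn : n < 0) : qFactorialInv x n = 0 := if_pos hn

theorem qFactorialInv_natCast (x : ℂ) (n : ℕ) : qFactorialInv x n = (qFactorial x n)⁻¹ := by
  simp [qFactorialInv]

/-- The extension by zero is consistent because the factor `1 - x ^ n` vanishes at `n = 0`; this
spares all boundary cases in the recurrence for `finiteThetaTerm`. -/
theorem qFactorialInv_sub_one {x : ℂ} (hx : ‖x‖ < 1) (n : ℤ) :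
    qFactorialInv x (n - 1) = (1 - x ^ n) * qFactorialInv x n := by
  rcases lt_trichotomy n 0 with hn | rfl | hn
  · rw [qFactorialInv_of_neg x hn, qFactorialInv_of_neg x (by omega), mul_zero]
  · rw [qFactorialInv_of_neg x (by omega)]
    simp
  · obtain ⟨m, rfl⟩ : ∃ m : ℕ, n = (m + 1 : ℕ) := ⟨n.toNat - 1, by omega⟩
    have h : (((m + 1 : ℕ) : ℤ) - 1) = (m : ℕ) := by push_cast; ring
    have h1 := qFactorial_ne_zero hx m
    have h2 := one_sub_pow_ne_zero hx (Nat.succ_ne_zero m)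
    rw [h, qFactorialInv_natCast, qFactorialInv_natCast, qFactorial_succ, zpow_natCast]
    field_simp

theorem exists_norm_qFactorialInv_le {x : ℂ} (hx : ‖x‖ < 1) :
    ∃ C, 0 < C ∧ ∀ n, ‖qFactorialInv x n‖ ≤ C := by
  obtain ⟨C, hC, h⟩ := exists_norm_qFactorial_inv_le hx
  refine ⟨C, hC, fun n => ?_⟩
  unfold qFactorialInv
  split_ifs
  · simpa using hC.le
  · exact h _

theorem tendsto_qFactorialInv {x : ℂ} (hx : ‖x‖ < 1) :
    Tendsto (qFactorialInv x) atTop (𝓝 (eulerProduct x)⁻¹) := by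
  have h : Tendsto (fun n : ℤ => (qFactorial x n.toNat)⁻¹) atTop (𝓝 (eulerProduct x)⁻¹) :=
    ((tendsto_qFactorial hx).inv₀ (eulerProduct_ne_zero hx)).comp
      (tendsto_atTop_atTop.mpr fun b => ⟨b, fun a ha => by omega⟩)
  refine h.congr' ?_
  filter_upwards [eventually_ge_atTop 0] with n hn
  rw [qFactorialInv, if_neg (by omega)]

/-! ### The Jacobi triple product. -/

/-- The terms of the finite form of the Jacobi triple product. -/
noncomputable def finiteThetaTerm (p z : ℂ) (N : ℕ) (j : ℤ) : ℂ :=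
  (-z) ^ j * p ^ (j * j) *
    (qFactorial (p ^ 2) (2 * N) * qFactorialInv (p ^ 2) (N + j) * qFactorialInv (p ^ 2) (N - j))

/-- The q-Pascal rule used twice on a Gaussian binomial. The three terms match the expansion of `(1
- z P) (1 - z⁻¹ P)` with `P = p ^ (2 * N + 1)`. Once every reciprocal factorial is expressed at `N +
1 ± j`, the claim is plain algebra. -/
theorem finiteThetaTerm_succ {p z : ℂ} (hp : ‖p‖ < 1) (hp0 : p ≠ 0) (hz : z ≠ 0) (N : ℕ) (j : ℤ) :
    finiteThetaTerm p z (N + 1) j =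
      (1 + p ^ (4 * N + 2)) * finiteThetaTerm p z N j
        - z * p ^ (2 * N + 1) * finiteThetaTerm p z N (j - 1)
        - z⁻¹ * p ^ (2 * N + 1) * finiteThetaTerm p z N (j + 1) := by
  have hx : ‖p ^ 2‖ < 1 := by
    rw [norm_pow]; exact pow_lt_one₀ (norm_nonneg p) hp two_ne_zero
  have hz' : -z ≠ 0 := neg_ne_zero.mpr hz
  simp only [finiteThetaTerm]
  have e1 : qFactorialInv (p ^ 2) (N + j) =
      (1 - (p ^ 2) ^ ((N : ℤ) + 1 + j)) * qFactorialInv (p ^ 2) (N + 1 + j) := by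
    rw [← qFactorialInv_sub_one hx]; congr 1; ring
  have e2 : qFactorialInv (p ^ 2) (N - j) =
      (1 - (p ^ 2) ^ ((N : ℤ) + 1 - j)) * qFactorialInv (p ^ 2) (N + 1 - j) := by
    rw [← qFactorialInv_sub_one hx]; congr 1; ring
  have e3 : qFactorialInv (p ^ 2) (N + (j - 1)) =
      (1 - (p ^ 2) ^ ((N : ℤ) + j)) * ((1 - (p ^ 2) ^ ((N : ℤ) + 1 + j)) *
        qFactorialInv (p ^ 2) (N + 1 + j)) := by
    rw [← e1, ← qFactorialInv_sub_one hx]; congr 1; ring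
  have e4 : qFactorialInv (p ^ 2) (N - (j + 1)) =
      (1 - (p ^ 2) ^ ((N : ℤ) - j)) * ((1 - (p ^ 2) ^ ((N : ℤ) + 1 - j)) *
        qFactorialInv (p ^ 2) (N + 1 - j)) := by
    rw [← e2, ← qFactorialInv_sub_one hx]; congr 1; ring
  have e5 : (N : ℤ) + (j + 1) = N + 1 + j := by ring
  have e6 : (N : ℤ) - (j - 1) = N + 1 - j := by ring
  have e7 : 2 * (N + 1) = 2 * N + 1 + 1 := by ring
  rw [e3, e4, e5, e6, e1, e2, e7, qFactorial_succ, qFactorial_succ]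
  push_cast
  have hp2 : p ^ 2 ≠ 0 := pow_ne_zero _ hp0
  have f1 : (-z) ^ (j - 1) = (-z) ^ j / (-z) := zpow_sub_one₀ hz' j
  have f2 : (-z) ^ (j + 1) = (-z) ^ j * (-z) := zpow_add_one₀ hz' j
  have f3 : p ^ ((j - 1) * (j - 1)) = p ^ (j * j) * p / (p ^ j) ^ 2 := by
    rw [show (j - 1) * (j - 1) = j * j + 1 - j * 2 by ring, zpow_sub₀ hp0, zpow_add₀ hp0,
      zpow_one, zpow_mul p j 2]
    norm_cast
  have f4 : p ^ ((j + 1) * (j + 1)) = p ^ (j * j) * p * (p ^ j) ^ 2 := by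
    rw [show (j + 1) * (j + 1) = j * j + 1 + j * 2 by ring, zpow_add₀ hp0, zpow_add₀ hp0,
      zpow_one, zpow_mul p j 2]
    norm_cast
  have f5 : (p ^ 2) ^ j = (p ^ j) ^ 2 := by
    rw [← zpow_natCast, ← zpow_natCast, ← zpow_mul, ← zpow_mul, mul_comm]
  have hb : p ^ j ≠ 0 := zpow_ne_zero _ hp0
  rw [f1, f2, f3, f4]
  simp only [zpow_add₀ hp2, zpow_sub₀ hp2, f5, zpow_natCast, zpow_one]
  generalize qFactorialInv (p ^ 2) (N + 1 + j) = E1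
  generalize qFactorialInv (p ^ 2) (N + 1 - j) = E2
  generalize qFactorial (p ^ 2) (2 * N) = F
  generalize (-z) ^ j = Z
  generalize p ^ (j * j) = W
  generalize p ^ j = b at *
  field_simp
  ring

theorem hasSum_finiteThetaTerm {p z : ℂ} (hp : ‖p‖ < 1) (hp0 : p ≠ 0) (hz : z ≠ 0) (N : ℕ) :
    HasSum (finiteThetaTerm p z N)
      (∏ k ∈ range N, ((1 - z * p ^ (2 * k + 1)) * (1 - z⁻¹ * p ^ (2 * k + 1)))) := by
  induction N with
  | zero =>
    have h := hasSum_single (f := finiteThetaTerm p z 0) 0 fun j hj => by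
      rcases lt_or_gt_of_ne hj with h | h
      · simp [finiteThetaTerm, qFactorialInv_of_neg _ h]
      · simp [finiteThetaTerm, qFactorialInv_of_neg _ (neg_lt_zero.mpr h)]
    simpa [finiteThetaTerm, qFactorialInv, qFactorial_zero] using h
  | succ N ih =>
    have h1 := (Equiv.subRight (1 : ℤ)).hasSum_iff.mpr ih
    have h2 := (Equiv.addRight (1 : ℤ)).hasSum_iff.mpr ih
    have h := ((ih.mul_left (1 + p ^ (4 * N + 2))).sub (h1.mul_left (z * p ^ (2 * N + 1)))).sub
      (h2.mul_left (z⁻¹ * p ^ (2 * N + 1)))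
    have hf := funext (finiteThetaTerm_succ hp hp0 hz N)
    rw [hf, prod_range_succ]
    have e : ∀ P : ℂ, P * ((1 - z * p ^ (2 * N + 1)) * (1 - z⁻¹ * p ^ (2 * N + 1))) =
        (1 + p ^ (4 * N + 2)) * P - z * p ^ (2 * N + 1) * P - z⁻¹ * p ^ (2 * N + 1) * P := fun P => by
      linear_combination P * p ^ (4 * N + 2) * mul_inv_cancel₀ hz
    rw [e]
    exact h

theorem summable_zpow_mul_zpow_sq {p z : ℂ} (hp : ‖p‖ < 1) (hp0 : p ≠ 0) (hz : z ≠ 0) :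
    Summable fun j : ℤ => z ^ j * p ^ (j * j) := by
  have key : ∀ w : ℂ, w ≠ 0 → Summable fun n : ℕ => w ^ n * p ^ (n * n) := by
    intro w hw
    refine summable_of_ratio_test_tendsto_lt_one (l := 0) one_pos
      (Eventually.of_forall fun n => mul_ne_zero (pow_ne_zero _ hw) (pow_ne_zero _ hp0)) ?_
    have h : Tendsto (fun n : ℕ => ‖w‖ * ‖p‖ * (‖p‖ ^ 2) ^ n) atTop (𝓝 (‖w‖ * ‖p‖ * 0)) :=
      (tendsto_pow_atTop_nhds_zero_of_lt_one (by positivity)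
        (pow_lt_one₀ (norm_nonneg p) hp two_ne_zero)).const_mul _
    rw [mul_zero] at h
    refine h.congr fun n => ?_
    have hw' := norm_ne_zero_iff.mpr hw
    have hp' := norm_ne_zero_iff.mpr hp0
    rw [show (n + 1) * (n + 1) = n * n + 2 * n + 1 by ring]
    simp only [norm_mul, norm_pow, pow_add, pow_mul, pow_one]
    field_simp
  refine Summable.of_nat_of_neg ((key z hz).congr fun n => ?_)
    ((key z⁻¹ (inv_ne_zero hz)).congr fun n => ?_)
  · norm_cast
  · rw [neg_mul_neg, zpow_neg, zpow_natCast, inv_pow]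
    norm_cast

/-- The Jacobi triple product identity. -/
theorem hasSum_jacobi_triple_product {p z : ℂ} (hp : ‖p‖ < 1) (hp0 : p ≠ 0) (hz : z ≠ 0) :
    HasSum (fun j : ℤ => (-z) ^ j * p ^ (j * j))
      (eulerProduct (p ^ 2) *
        ∏' k : ℕ, ((1 - z * p ^ (2 * k + 1)) * (1 - z⁻¹ * p ^ (2 * k + 1)))) := by
  have hx : ‖p ^ 2‖ < 1 := by
    rw [norm_pow]; exact pow_lt_one₀ (norm_nonneg p) hp two_ne_zero
  have hE := eulerProduct_ne_zero hx
  have hs := summable_zpow_mul_zpow_sq hp hp0 (neg_ne_zero.mpr hz)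
  obtain ⟨C, hC, hC'⟩ := exists_norm_qFactorial_le hx
  obtain ⟨D, hD, hD'⟩ := exists_norm_qFactorialInv_le hx
  -- As `N → ∞` the Gaussian binomials tend to `E * E⁻¹ * E⁻¹`, where `E = eulerProduct (p ^ 2)`,
  -- and are bounded uniformly in `N` and `j`.
  have hlim := tendsto_tsum_of_dominated_convergence (𝓕 := atTop)
    (f := fun N j => finiteThetaTerm p z N j)
    (g := fun j : ℤ => (-z) ^ j * p ^ (j * j) * (eulerProduct (p ^ 2))⁻¹)
    (bound := fun j : ℤ => ‖(-z) ^ j * p ^ (j * j)‖ * (C * D * D)) (hs.norm.mul_right _)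
    (fun j => by
      have h1 := (tendsto_qFactorial hx).comp
        (tendsto_id.const_mul_atTop' (two_pos (α := ℕ)))
      have h2 := (tendsto_qFactorialInv hx).comp
        (tendsto_atTop_add_const_right _ j (tendsto_natCast_atTop_atTop (R := ℤ)))
      have h3 := (tendsto_qFactorialInv hx).comp
        (tendsto_atTop_add_const_right _ (-j) (tendsto_natCast_atTop_atTop (R := ℤ)))
      have h := ((h1.mul h2).mul h3).const_mul ((-z) ^ j * p ^ (j * j))
      rw [mul_inv_cancel₀ hE, one_mul] at h
      exact h)
    (Eventually.of_forall fun N j => by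
      rw [finiteThetaTerm, norm_mul]
      gcongr
      rw [norm_mul, norm_mul]
      gcongr
      · exact hC' _
      · exact hD' _
      · exact hD' _)
  have hm := ((multipliable_one_sub_mul_pow hp z two_ne_zero 1).mul
    (multipliable_one_sub_mul_pow hp z⁻¹ two_ne_zero 1)).hasProd.tendsto_prod_nat
  simp only [fun N => (hasSum_finiteThetaTerm hp hp0 hz N).tsum_eq] at hlim
  have h := tendsto_nhds_unique hm hlim
  rw [tsum_mul_right] at h
  rw [h]
  convert hs.hasSum using 1
  field_simp

/-- The triple product at base `q ^ 5` and `z = q ^ c`, with the terms `j = n` and `j = -(n + 1)`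
paired. -/
theorem hasSum_theta_pentagonal_type {q : ℂ} (hq : ‖q‖ < 1) (hq0 : q ≠ 0) {c d : ℕ}
    (hcd : c + d = 5) :
    HasSum (fun n : ℕ => (-1) ^ n * q ^ (5 * n ^ 2 + c * n) * (1 - q ^ (2 * d * n + d)))
      (eulerProduct (q ^ 10) *
        ∏' k : ℕ, ((1 - q ^ (10 * k + (5 + c))) * (1 - q ^ (10 * k + d)))) := by
  have hp : ‖q ^ 5‖ < 1 := by
    rw [norm_pow]; exact pow_lt_one₀ (norm_nonneg q) hq (by norm_num)
  have h := (hasSum_jacobi_triple_product hp (pow_ne_zero 5 hq0) (pow_ne_zero c hq0)).nat_add_neg_add_one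
  have e1 : ∀ k : ℕ, q ^ c * (q ^ 5) ^ (2 * k + 1) = q ^ (10 * k + (5 + c)) := fun k => by ring
  have e2 : ∀ k : ℕ, (q ^ c)⁻¹ * (q ^ 5) ^ (2 * k + 1) = q ^ (10 * k + d) := fun k => by
    rw [inv_mul_eq_iff_eq_mul₀ (pow_ne_zero c hq0), ← pow_mul, ← pow_add]
    congr 1
    omega
  simp only [e1, e2] at h
  rw [show (q ^ 5) ^ 2 = q ^ 10 by ring] at h
  convert h using 2 with n
  have f1 : (-q ^ c) ^ (-((n : ℤ) + 1)) = (-1) ^ (n + 1) * (q ^ (c * (n + 1)))⁻¹ := by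
    rw [zpow_neg, ← Nat.cast_succ, zpow_natCast, neg_pow, mul_inv, ← inv_pow, inv_neg_one, ← pow_mul]
  have f2 : (q ^ 5) ^ (-((n : ℤ) + 1) * -((n : ℤ) + 1)) = q ^ (5 * ((n + 1) * (n + 1))) := by
    rw [neg_mul_neg, pow_mul]
    norm_cast
  have f3 : (-q ^ c) ^ (n : ℤ) * (q ^ 5) ^ ((n : ℤ) * n) = (-1) ^ n * q ^ (5 * n ^ 2 + c * n) := by
    rw [← Nat.cast_mul, zpow_natCast, zpow_natCast, neg_pow]
    ring
  have f4 : q ^ (5 * ((n + 1) * (n + 1))) =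
      q ^ (c * (n + 1)) * (q ^ (5 * n ^ 2 + c * n) * q ^ (2 * d * n + d)) := by
    rw [← pow_add, ← pow_add]
    congr 1
    have hcd' : (c : ℤ) + d = 5 := by exact_mod_cast hcd
    zify
    linear_combination -(2 * (n : ℤ) + 1) * hcd'
  have hc := pow_ne_zero (c * (n + 1)) hq0
  rw [f1, f2, f3, f4]
  field_simp
  ring

/-! ### The Rogers-Selberg series. -/

/-- Terms of the Rogers-Selberg series, in the base `q ^ 2`. -/
noncomputable def rogersSelbergTerm (q : ℂ) (m r : ℕ) : ℂ :=
  (-1) ^ r * q ^ (5 * r ^ 2 + r + 4 * m * r) * (1 - q ^ (4 * m + 4 + 8 * r)) *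
    (qFactorial (q ^ 2) (m + r) * (qFactorial (q ^ 2) r)⁻¹)

/-- Terms of the companion of the Rogers-Selberg series, in the base `q ^ 2`. -/
noncomputable def rogersSelbergTerm' (q : ℂ) (m r : ℕ) : ℂ :=
  (-1) ^ r * q ^ (5 * r ^ 2 + 3 * r + 4 * m * r) * (1 - q ^ (2 * m + 2 + 4 * r)) *
    (qFactorial (q ^ 2) (m + r) * (qFactorial (q ^ 2) r)⁻¹)

/-- The Rogers-Selberg series with parameter `a = q ^ (2 m + 2)`, in the base `q ^ 2`. -/
noncomputable def rogersSelbergSeries (q : ℂ) (m : ℕ) : ℂ := ∑' r : ℕ, rogersSelbergTerm q m r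

theorem norm_sq_lt_one {q : ℂ} (hq : ‖q‖ < 1) : ‖q ^ 2‖ < 1 := by
  rw [norm_pow]; exact pow_lt_one₀ (norm_nonneg q) hq two_ne_zero

theorem exists_norm_qFactorial_ratio_le {x : ℂ} (hx : ‖x‖ < 1) :
    ∃ C, 0 < C ∧ ∀ n r, ‖qFactorial x n * (qFactorial x r)⁻¹‖ ≤ C := by
  obtain ⟨C, hC, hC'⟩ := exists_norm_qFactorial_le hx
  obtain ⟨D, hD, hD'⟩ := exists_norm_qFactorial_inv_le hx
  refine ⟨C * D, by positivity, fun n r => ?_⟩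
  rw [norm_mul]
  gcongr
  · exact hC' n
  · exact hD' r

theorem norm_one_sub_pow_le {q : ℂ} (hq : ‖q‖ < 1) (n : ℕ) : ‖1 - q ^ n‖ ≤ 2 := by
  have h1 : ‖q ^ n‖ ≤ 1 := by rw [norm_pow]; exact pow_le_one₀ (norm_nonneg q) hq.le
  have h2 := norm_sub_le (1 : ℂ) (q ^ n)
  rw [norm_one] at h2
  linarith

theorem norm_signed_pow_mul_le {q : ℂ} (hq : ‖q‖ < 1) {r e : ℕ} (h : r ≤ e) {a b : ℂ} {A B : ℝ}
    (ha : ‖a‖ ≤ A) (hb : ‖b‖ ≤ B) : ‖(-1) ^ r * q ^ e * a * b‖ ≤ ‖q‖ ^ r * (A * B) := by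
  have hA : 0 ≤ A := (norm_nonneg a).trans ha
  rw [norm_mul, norm_mul, norm_mul, norm_pow, norm_pow, norm_neg, norm_one, one_pow, one_mul,
    mul_assoc]
  gcongr ?_ * (?_ * ?_)
  exact pow_le_pow_of_le_one (norm_nonneg q) hq.le h

theorem summable_signed_pow_mul {q : ℂ} (hq : ‖q‖ < 1) {e : ℕ → ℕ} (h : ∀ r, r ≤ e r)
    {a b : ℕ → ℂ} {A B : ℝ} (ha : ∀ r, ‖a r‖ ≤ A) (hb : ∀ r, ‖b r‖ ≤ B) :
    Summable fun r : ℕ => (-1) ^ r * q ^ e r * a r * b r :=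
  .of_norm_bounded ((summable_geometric_of_lt_one (norm_nonneg q) hq).mul_right (A * B))
    fun r => norm_signed_pow_mul_le hq (h r) (ha r) (hb r)

theorem tsum_add_eq_of_shift {A B : ℕ → ℂ} (hA : Summable A) (hB : Summable B) (h0 : B 0 = 0) :
    ∑' r, (A r + B r) = ∑' r, (A r + B (r + 1)) := by
  rw [hA.tsum_add hB, hA.tsum_add ((summable_nat_add_iff 1).mpr hB), hB.tsum_eq_zero_add, h0,
    zero_add]

theorem summable_rogersSelbergTerm' {q : ℂ} (hq : ‖q‖ < 1) (m : ℕ) :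
    Summable (rogersSelbergTerm' q m) := by
  obtain ⟨C, -, hC⟩ := exists_norm_qFactorial_ratio_le (norm_sq_lt_one hq)
  exact summable_signed_pow_mul hq (fun r => by nlinarith) (fun r => norm_one_sub_pow_le hq _)
    (fun r => hC _ _)

/-- With `x = q ^ 2`, split `1 - x^(m+1+2r) = x^r (1 - x^(m+r+1)) + (1 - x^r)`. The first factor is
absorbed by the upper factorial, the second by the lower one after shifting `r`. -/
theorem tsum_rogersSelbergTerm' {q : ℂ} (hq : ‖q‖ < 1) (m : ℕ) :
    ∑' r, rogersSelbergTerm' q m r = rogersSelbergSeries q (m + 1) := by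
  obtain ⟨C, -, hC⟩ := exists_norm_qFactorial_ratio_le (norm_sq_lt_one hq)
  have hA : Summable fun r : ℕ => (-1) ^ r * q ^ (5 * r ^ 2 + 5 * r + 4 * m * r) * 1 *
      (qFactorial (q ^ 2) (m + r + 1) * (qFactorial (q ^ 2) r)⁻¹) :=
    summable_signed_pow_mul hq (fun r => by nlinarith) (fun r => norm_one.le) (fun r => hC _ _)
  have hB : Summable fun r : ℕ => (-1) ^ r * q ^ (5 * r ^ 2 + 3 * r + 4 * m * r) *
      (1 - q ^ (2 * r)) * (qFactorial (q ^ 2) (m + r) * (qFactorial (q ^ 2) r)⁻¹) :=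
    summable_signed_pow_mul hq (fun r => by nlinarith) (fun r => norm_one_sub_pow_le hq _)
      (fun r => hC _ _)
  rw [rogersSelbergSeries]
  refine Eq.trans (tsum_congr fun r => ?_)
    ((tsum_add_eq_of_shift hA hB (by simp)).trans (tsum_congr fun r => ?_))
  · rw [rogersSelbergTerm', qFactorial_succ]
    ring
  · have h1 := one_sub_pow_ne_zero (norm_sq_lt_one hq) (Nat.succ_ne_zero r)
    have h2 := qFactorial_ne_zero (norm_sq_lt_one hq) r
    rw [rogersSelbergTerm, qFactorial_succ _ r, show m + (r + 1) = m + r + 1 by ring,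
      show m + 1 + r = m + r + 1 by ring, pow_mul q 2 (r + 1)]
    field_simp
    ring

theorem rogersSelbergSeries_recurrence {q : ℂ} (hq : ‖q‖ < 1) (m : ℕ) :
    rogersSelbergSeries q m =
      rogersSelbergSeries q (m + 1) + q ^ (2 * (m + 1)) * rogersSelbergSeries q (m + 2) := by
  obtain ⟨C, -, hC⟩ := exists_norm_qFactorial_ratio_le (norm_sq_lt_one hq)
  have hA : Summable fun r : ℕ => (-1) ^ r * q ^ (5 * r ^ 2 + 7 * r + 4 * m * r + 2 * m + 2) * 1 *
      (qFactorial (q ^ 2) (m + r + 1) * (qFactorial (q ^ 2) r)⁻¹) :=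
    summable_signed_pow_mul hq (fun r => by nlinarith) (fun r => norm_one.le) (fun r => hC _ _)
  have hB : Summable fun r : ℕ => (-1) ^ r * q ^ (5 * r ^ 2 + r + 4 * m * r) *
      (1 - q ^ (2 * r)) * (qFactorial (q ^ 2) (m + r) * (qFactorial (q ^ 2) r)⁻¹) :=
    summable_signed_pow_mul hq (fun r => by nlinarith) (fun r => norm_one_sub_pow_le hq _)
      (fun r => hC _ _)
  have hAB := tsum_add_eq_of_shift hA hB (by simp)
  rw [← tsum_rogersSelbergTerm' hq m, show m + 2 = m + 1 + 1 from rfl,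
    ← tsum_rogersSelbergTerm' hq (m + 1), ← tsum_mul_left]
  rw [rogersSelbergSeries]
  -- The splitting, with `x = q ^ 2`, is `1 - x^(2m+2+4r) = x^r (1 - x^(m+1+2r)) + x^(m+1+3r) (1 -
  -- x^(m+r+1)) + (1 - x^r)`.
  refine Eq.trans (tsum_congr fun r => ?_) (((summable_rogersSelbergTerm' hq m).tsum_add
    (hA.add hB)).trans (congrArg₂ _ rfl (hAB.trans (tsum_congr fun r => ?_))))
  · rw [rogersSelbergTerm', rogersSelbergTerm, qFactorial_succ]
    ring
  · have h1 := one_sub_pow_ne_zero (norm_sq_lt_one hq) (Nat.succ_ne_zero r)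
    have h2 := qFactorial_ne_zero (norm_sq_lt_one hq) r
    rw [rogersSelbergTerm', qFactorial_succ _ r, show m + (r + 1) = m + r + 1 by ring,
      show m + 1 + r = m + r + 1 by ring, pow_mul q 2 (r + 1)]
    field_simp
    ring

/-- The factor `q ^ (4 * m * r)` kills every term with `r > 0` in the limit. -/
theorem tendsto_rogersSelbergSeries {q : ℂ} (hq : ‖q‖ < 1) :
    Tendsto (rogersSelbergSeries q) atTop (𝓝 (eulerProduct (q ^ 2))) := by
  have hx := norm_sq_lt_one hq
  obtain ⟨C, -, hC⟩ := exists_norm_qFactorial_ratio_le hx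
  have hpow : ∀ n : ℕ, n ≠ 0 → Tendsto (fun m : ℕ => (q ^ n) ^ m) atTop (𝓝 0) := fun n hn =>
    tendsto_pow_atTop_nhds_zero_of_norm_lt_one (by
      rw [norm_pow]; exact pow_lt_one₀ (norm_nonneg q) hq hn)
  have h := tendsto_tsum_of_dominated_convergence (𝓕 := atTop)
    (f := rogersSelbergTerm q)
    (g := fun r : ℕ => (-1) ^ r * (q ^ (5 * r ^ 2 + r) * if r = 0 then 1 else 0) *
      (1 - q ^ (4 + 8 * r) * 0) * (eulerProduct (q ^ 2) * (qFactorial (q ^ 2) r)⁻¹))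
    (bound := fun r => ‖q‖ ^ r * (2 * C))
    ((summable_geometric_of_lt_one (norm_nonneg q) hq).mul_right _)
    (fun r => by
      have h1 : Tendsto (fun m : ℕ => (q ^ (4 * r)) ^ m) atTop (𝓝 (if r = 0 then 1 else 0)) := by
        split_ifs with hr
        · simp [hr]
        · exact hpow _ (by omega)
      have h2 := ((tendsto_qFactorial hx).comp (tendsto_add_atTop_nat r)).mul_const
        (qFactorial (q ^ 2) r)⁻¹
      refine ((((h1.const_mul (q ^ (5 * r ^ 2 + r))).const_mul ((-1) ^ r)).mul
        (((hpow 4 four_ne_zero).const_mul (q ^ (4 + 8 * r))).const_sub 1)).mul h2).congr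
          fun m => ?_
      simp only [rogersSelbergTerm, Function.comp]
      ring)
    (Eventually.of_forall fun m r =>
      norm_signed_pow_mul_le hq (by nlinarith) (norm_one_sub_pow_le hq _) (hC _ _))
  rw [tsum_eq_single 0 fun r hr => by simp [hr]] at h
  simpa [qFactorial_zero] using! h

theorem rogersSelbergSeries_zero {q : ℂ} (hq : ‖q‖ < 1) (hq0 : q ≠ 0) :
    rogersSelbergSeries q 0 = eulerProduct (q ^ 10) *
      ∏' k : ℕ, ((1 - q ^ (10 * k + 6)) * (1 - q ^ (10 * k + 4))) := by
  rw [← (hasSum_theta_pentagonal_type hq hq0 (c := 1) (d := 4) rfl).tsum_eq, rogersSelbergSeries]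
  refine tsum_congr fun r => ?_
  rw [rogersSelbergTerm, zero_add, mul_inv_cancel₀ (qFactorial_ne_zero (norm_sq_lt_one hq) r)]
  ring

/-- The companion series at `m = 0` is used because its factorial ratio is 1, leaving a pure theta
series. -/
theorem rogersSelbergSeries_one {q : ℂ} (hq : ‖q‖ < 1) (hq0 : q ≠ 0) :
    rogersSelbergSeries q 1 = eulerProduct (q ^ 10) *
      ∏' k : ℕ, ((1 - q ^ (10 * k + 8)) * (1 - q ^ (10 * k + 2))) := by
  rw [← (hasSum_theta_pentagonal_type hq hq0 (c := 3) (d := 2) rfl).tsum_eq,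
    ← zero_add 1, ← tsum_rogersSelbergTerm' hq]
  refine tsum_congr fun r => ?_
  rw [rogersSelbergTerm', zero_add, mul_inv_cancel₀ (qFactorial_ne_zero (norm_sq_lt_one hq) r)]
  ring

/-! ### Limits of solutions of the three-term recurrence. -/

/-- Each step multiplies the maximum of two consecutive norms by at most `1 + ‖x‖ ^ n ≤ exp (‖x‖ ^
n)`. -/
theorem norm_le_exp_of_recurrence {x : ℂ} (hx : ‖x‖ < 1) {u : ℕ → ℂ}
    (hu : ∀ n, u (n + 2) = u (n + 1) + x ^ (n + 1) * u n) (n : ℕ) :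
    ‖u n‖ ≤ Real.exp (1 - ‖x‖)⁻¹ * max ‖u 0‖ ‖u 1‖ := by
  have key : ∀ n, max ‖u n‖ ‖u (n + 1)‖ ≤
      Real.exp (∑ i ∈ range n, ‖x‖ ^ i) * max ‖u 0‖ ‖u 1‖ := by
    intro n
    induction n with
    | zero => simp
    | succ n ih =>
      set M := max ‖u n‖ ‖u (n + 1)‖
      have h0 : ‖u n‖ ≤ M := le_max_left _ _
      have h1 : ‖u (n + 1)‖ ≤ M := le_max_right _ _
      have hM : 0 ≤ M := (norm_nonneg _).trans h0
      have h2 : ‖u (n + 2)‖ ≤ (‖x‖ ^ n + 1) * M := by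
        calc ‖u (n + 2)‖ ≤ ‖u (n + 1)‖ + ‖x‖ ^ (n + 1) * ‖u n‖ := by
              rw [hu, ← norm_pow, ← norm_mul]; exact norm_add_le _ _
          _ ≤ M + ‖x‖ ^ n * M := by
              gcongr ?_ + ?_ * ?_
              exact pow_le_pow_of_le_one (norm_nonneg x) hx.le n.le_succ
          _ = _ := by ring
      have h3 : M ≤ (‖x‖ ^ n + 1) * M := le_mul_of_one_le_left hM (by simp)
      have h4 := Real.add_one_le_exp (‖x‖ ^ n)
      rw [sum_range_succ, Real.exp_add]
      calc max ‖u (n + 1)‖ ‖u (n + 1 + 1)‖ ≤ (‖x‖ ^ n + 1) * M := max_le (h1.trans h3) h2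
        _ ≤ Real.exp (‖x‖ ^ n) *
            (Real.exp (∑ i ∈ range n, ‖x‖ ^ i) * max ‖u 0‖ ‖u 1‖) := by gcongr
        _ = _ := by ring
  refine (le_max_left _ _).trans ((key n).trans ?_)
  gcongr
  rw [← tsum_geometric_of_lt_one (norm_nonneg x) hx]
  exact (summable_geometric_of_lt_one (norm_nonneg x) hx).sum_le_tsum _ fun i _ => by positivity

theorem tendsto_of_dual_recurrences {x : ℂ} (hx : ‖x‖ < 1) {u F : ℕ → ℂ} {L : ℂ}
    (hu : ∀ n, u (n + 2) = u (n + 1) + x ^ (n + 1) * u n)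
    (hF : ∀ n, F n = F (n + 1) + x ^ (n + 1) * F (n + 2)) (hL : Tendsto F atTop (𝓝 L))
    (hL0 : L ≠ 0) : Tendsto u atTop (𝓝 ((u 1 * F 1 + x * u 0 * F 2) / L)) := by
  -- The conserved pairing; its second summand tends to 0, so `u (n + 1) * F (n + 1)` converges.
  have inv : ∀ n, u (n + 1) * F (n + 1) + x ^ (n + 1) * u n * F (n + 2) =
      u 1 * F 1 + x * u 0 * F 2 := by
    intro n
    induction n with
    | zero => simp
    | succ n ih =>
      rw [← ih, hu, hF (n + 1)]
      ring
  have hF1 := (tendsto_add_atTop_iff_nat 1).mpr hL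
  have hF2 := (tendsto_add_atTop_iff_nat 2).mpr hL
  have hzero : Tendsto (fun n => x ^ (n + 1) * u n) atTop (𝓝 0) := by
    refine squeeze_zero_norm (a := fun n =>
      ‖x‖ ^ (n + 1) * (Real.exp (1 - ‖x‖)⁻¹ * max ‖u 0‖ ‖u 1‖)) (fun n => ?_) ?_
    · rw [norm_mul, norm_pow]
      gcongr
      exact norm_le_exp_of_recurrence hx hu n
    · have h := (tendsto_add_atTop_iff_nat 1).mpr
        (tendsto_pow_atTop_nhds_zero_of_lt_one (norm_nonneg x) hx)
      simpa using h.mul_const (Real.exp (1 - ‖x‖)⁻¹ * max ‖u 0‖ ‖u 1‖)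
  rw [← tendsto_add_atTop_iff_nat 1]
  have h := ((hzero.mul hF2).const_sub (u 1 * F 1 + x * u 0 * F 2)).div hF1 hL0
  rw [zero_mul, sub_zero] at h
  refine h.congr' ?_
  filter_upwards [hF1.eventually_ne hL0] with n hn
  rw [← inv n]
  simp only [Pi.div_apply]
  field_simp
  ring

/-! ### The continued fraction and the Rogers product. -/

theorem nome_ne_zero (τ : ℂ) : nome τ ≠ 0 := Complex.exp_ne_zero _

theorem tendsto_rogersRamanujanFraction_convs (τ : ℂ) (hq : ‖nome τ‖ < 1) :
    Tendsto (fun n : ℕ => (rogersRamanujanFraction τ).convs n) atTop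
      (𝓝 (nomeTwoFifths τ *
        (rogersSelbergSeries (nome τ) 1 / rogersSelbergSeries (nome τ) 0))) := by
  set q := nome τ with hqdef
  have hq0 : q ≠ 0 := nome_ne_zero τ
  have hx := norm_sq_lt_one hq
  have hE := eulerProduct_ne_zero hx
  have hF : ∀ n, rogersSelbergSeries q n = rogersSelbergSeries q (n + 1) +
      (q ^ 2) ^ (n + 1) * rogersSelbergSeries q (n + 2) := fun n => by
    rw [← pow_mul]; exact rogersSelbergSeries_recurrence hq n
  have hF0 : rogersSelbergSeries q 0 ≠ 0 := by
    have hq10 : ‖q ^ 10‖ < 1 := by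
      rw [norm_pow]; exact pow_lt_one₀ (norm_nonneg q) hq (by norm_num)
    have h6 := multipliable_one_sub_mul_pow hq 1 (a := 10) (by norm_num) 6
    have h4 := multipliable_one_sub_mul_pow hq 1 (a := 10) (by norm_num) 4
    simp only [one_mul] at h6 h4
    rw [rogersSelbergSeries_zero hq hq0, h6.tprod_mul h4]
    exact mul_ne_zero (eulerProduct_ne_zero hq10) (mul_ne_zero
      (tprod_one_sub_pow_ne_zero hq (by norm_num) (by norm_num))
      (tprod_one_sub_pow_ne_zero hq (by norm_num) (by norm_num)))
  -- The uniform recurrence starts only after the exceptional first numerator `q^{2/5}`; `contsAux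
  -- (n + 1)` holds the `n`-th convergent.
  have hrec : ∀ n, (rogersRamanujanFraction τ).contsAux (n + 3) =
      ⟨((rogersRamanujanFraction τ).contsAux (n + 2)).a +
          (q ^ 2) ^ (n + 1) * ((rogersRamanujanFraction τ).contsAux (n + 1)).a,
        ((rogersRamanujanFraction τ).contsAux (n + 2)).b +
          (q ^ 2) ^ (n + 1) * ((rogersRamanujanFraction τ).contsAux (n + 1)).b⟩ := fun n => by
    have h : (rogersRamanujanFraction τ).s.get? (n + 1) = some ⟨q ^ (2 * (n + 1)), 1⟩ := rfl
    rw [GenContFract.contsAux_recurrence h rfl rfl]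
    simp only [one_mul, pow_mul]
  have h1 : (rogersRamanujanFraction τ).contsAux 1 = ⟨0, 1⟩ := rfl
  have h2 : (rogersRamanujanFraction τ).contsAux 2 = ⟨nomeTwoFifths τ, 1⟩ := by
    have h : (rogersRamanujanFraction τ).s.get? 0 = some ⟨nomeTwoFifths τ, 1⟩ := rfl
    rw [GenContFract.contsAux_recurrence h rfl rfl]
    simp [rogersRamanujanFraction]
  have hnum := tendsto_of_dual_recurrences hx
    (u := fun n => ((rogersRamanujanFraction τ).contsAux (n + 1)).a)
    (fun n => by simp only [hrec]) hF (tendsto_rogersSelbergSeries hq) hE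
  have hden := tendsto_of_dual_recurrences hx
    (u := fun n => ((rogersRamanujanFraction τ).contsAux (n + 1)).b)
    (fun n => by simp only [hrec]) hF (tendsto_rogersSelbergSeries hq) hE
  -- Initial values `0, q^{2/5}` give the numerator limit `q^{2/5} F 1 / E`; the values `1, 1` give
  -- `(F 1 + x F 2) / E = F 0 / E`.
  have hF00 := hF 0
  rw [zero_add, pow_one] at hF00
  simp only [zero_add, one_add_one_eq_two, h1, h2, mul_zero, zero_mul, add_zero, one_mul,
    mul_one, ← hF00] at hnum hden
  have h := hnum.div hden (div_ne_zero hF0 hE)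
  rw [div_div_div_cancel_right₀ hE, mul_div_assoc] at h
  exact h

theorem hasProd_rogersFactor {q : ℂ} (hq : ‖q‖ < 1) (hq0 : q ≠ 0) :
    HasProd (rogersFactor q) (rogersSelbergSeries q 1 / rogersSelbergSeries q 0) := by
  have hq10 : ‖q ^ 10‖ < 1 := by
    rw [norm_pow]; exact pow_lt_one₀ (norm_nonneg q) hq (by norm_num)
  have hm : ∀ b, Multipliable fun k : ℕ => 1 - q ^ (10 * k + b) := fun b => by
    simpa only [one_mul] using multipliable_one_sub_mul_pow hq 1 (a := 10) (by norm_num) b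
  rw [rogersSelbergSeries_zero hq hq0, rogersSelbergSeries_one hq hq0,
    mul_div_mul_left _ _ (eulerProduct_ne_zero hq10)]
  refine ((hm 8).mul (hm 2)).hasProd.div₀ ((hm 6).mul (hm 4)).hasProd ?_
  rw [(hm 6).tprod_mul (hm 4)]
  exact mul_ne_zero (tprod_one_sub_pow_ne_zero hq (by norm_num) (by norm_num))
    (tprod_one_sub_pow_ne_zero hq (by norm_num) (by norm_num))

/-! ### The exponential expansion. -/

theorem Summable.exists_norm_le_lt_one {u : ℕ → ℂ} (hs : Summable fun k => ‖u k‖)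
    (hu : ∀ k, ‖u k‖ < 1) : ∃ ρ : ℝ, 0 ≤ ρ ∧ ρ < 1 ∧ ∀ k, ‖u k‖ ≤ ρ := by
  have key : ∀ N : ℕ, ∃ ρ : ℝ, 0 ≤ ρ ∧ ρ < 1 ∧ ∀ k < N, ‖u k‖ ≤ ρ := by
    intro N
    induction N with
    | zero => exact ⟨0, le_rfl, one_pos, fun k hk => absurd hk k.not_lt_zero⟩
    | succ N ih =>
      obtain ⟨ρ, h0, h1, h⟩ := ih
      refine ⟨max ρ ‖u N‖, h0.trans (le_max_left _ _), max_lt h1 (hu N), fun k hk => ?_⟩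
      rcases Nat.lt_succ_iff_lt_or_eq.mp hk with hk | rfl
      · exact (h k hk).trans (le_max_left _ _)
      · exact le_max_right _ _
  obtain ⟨N, hN⟩ := eventually_atTop.mp
    (hs.tendsto_atTop_zero.eventually_le_const (by norm_num : (0 : ℝ) < 1 / 2))
  obtain ⟨ρ, h0, h1, h⟩ := key N
  refine ⟨max ρ (1 / 2), h0.trans (le_max_left _ _), max_lt h1 (by norm_num), fun k => ?_⟩
  rcases lt_or_ge k N with hk | hk
  · exact (h k hk).trans (le_max_left _ _)
  · exact (hN k hk).trans (le_max_right _ _)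

/-- A uniform bound `ρ < 1` on the norms gives the summable majorant `ρ ^ p * ‖u k‖`. -/
theorem summable_neg_log_expansion {u : ℕ → ℂ} (hs : Summable fun k => ‖u k‖)
    (hu : ∀ k, ‖u k‖ < 1) :
    Summable fun x : ℕ × ℕ => u x.2 ^ (x.1 + 1) / ((x.1 + 1 : ℕ) : ℂ) := by
  obtain ⟨ρ, h0, h1, h⟩ := hs.exists_norm_le_lt_one hu
  refine .of_norm_bounded ((summable_geometric_of_lt_one h0 h1).mul_of_nonneg hs
    (fun n => by positivity) fun k => norm_nonneg _) fun x => ?_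
  rw [norm_div, norm_pow, Complex.norm_natCast, pow_succ]
  refine (div_le_self (by positivity) (by simp)).trans ?_
  gcongr
  exact h _

theorem hasSum_neg_log_one_sub {z : ℂ} (hz : ‖z‖ < 1) :
    HasSum (fun p : ℕ => z ^ (p + 1) / ((p + 1 : ℕ) : ℂ)) (-Complex.log (1 - z)) := by
  have h := (hasSum_nat_add_iff' 1).mpr (Complex.hasSum_taylorSeries_neg_log hz)
  simpa using h

theorem hasProd_exp_log_expansion {u v : ℕ → ℂ} (hsu : Summable fun k => ‖u k‖)
    (hsv : Summable fun k => ‖v k‖) (hu : ∀ k, ‖u k‖ < 1) (hv : ∀ k, ‖v k‖ < 1) :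
    HasProd (fun k => (1 - v k) / (1 - u k)) (Complex.exp (∑' x : ℕ × ℕ,
      (u x.2 ^ (x.1 + 1) / ((x.1 + 1 : ℕ) : ℂ) - v x.2 ^ (x.1 + 1) / ((x.1 + 1 : ℕ) : ℂ)))) := by
  have hne : ∀ z : ℂ, ‖z‖ < 1 → 1 - z ≠ 0 := fun z hz h => by
    rw [← sub_eq_zero.mp h, norm_one] at hz
    exact lt_irrefl _ hz
  have hs := ((summable_neg_log_expansion hsu hu).sub (summable_neg_log_expansion hsv hv)).hasSum
  have hfib : ∀ k, HasSum (fun p : ℕ => u k ^ (p + 1) / ((p + 1 : ℕ) : ℂ) -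
      v k ^ (p + 1) / ((p + 1 : ℕ) : ℂ)) (-Complex.log (1 - u k) - -Complex.log (1 - v k)) :=
    fun k => (hasSum_neg_log_one_sub (hu k)).sub (hasSum_neg_log_one_sub (hv k))
  -- Absolute convergence allows summing over `p` first; exponentiating the sum over `k` removes any
  -- question of branches.
  have h := (HasSum.prod_fiberwise ((Equiv.prodComm ℕ ℕ).hasSum_iff.mpr hs) hfib).cexp
  have he : (Complex.exp ∘ fun k => -Complex.log (1 - u k) - -Complex.log (1 - v k)) =
      fun k => (1 - v k) / (1 - u k) := by
    funext k
    rw [Function.comp_apply, Complex.exp_sub, Complex.exp_neg, Complex.exp_neg,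
      Complex.exp_log (hne _ (hu k)), Complex.exp_log (hne _ (hv k)), inv_div_inv]
  rw [he] at h
  exact h

theorem sin_sq_eq_nome (τ : ℂ) (m : ℕ) :
    Complex.sin (m * (Real.pi * τ / 2)) ^ 2 = -(1 - nome τ ^ m) ^ 2 / (4 * nome τ ^ m) := by
  set w := Complex.exp (m * (Real.pi * τ / 2) * Complex.I) with hw
  have hw0 : w ≠ 0 := Complex.exp_ne_zero _
  have h : nome τ ^ m = w ^ 2 := by
    rw [hw, nome, ← Complex.exp_nat_mul, ← Complex.exp_nat_mul]
    congr 1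
    push_cast
    ring
  have hs : Complex.sin (m * (Real.pi * τ / 2)) = (w⁻¹ - w) * Complex.I / 2 := by
    rw [Complex.sin, neg_mul, Complex.exp_neg]
  rw [hs, h, div_pow, mul_pow, Complex.I_sq]
  field_simp
  ring

theorem summable_norm_const_div_sin_sq {τ : ℂ} (hq : ‖nome τ‖ < 1) (c : ℂ) :
    Summable fun k : ℕ => ‖c / Complex.sin ((10 * k + 5 : ℕ) * (Real.pi * τ / 2)) ^ 2‖ := by
  refine .of_nonneg_of_le (fun k => norm_nonneg _) (fun k => ?_)
    ((summable_geometric_of_lt_one (norm_nonneg _) hq).mul_left (‖c‖ * (4 / (1 - ‖nome τ‖) ^ 2)))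
  have h1 : 1 - ‖nome τ‖ ≤ ‖1 - nome τ ^ (10 * k + 5)‖ := by
    have h2 := norm_sub_norm_le (1 : ℂ) (nome τ ^ (10 * k + 5))
    rw [norm_one, norm_pow] at h2
    have h3 : ‖nome τ‖ ^ (10 * k + 5) ≤ ‖nome τ‖ ^ 1 :=
      pow_le_pow_of_le_one (norm_nonneg _) hq.le (by omega)
    rw [pow_one] at h3
    linarith
  have h4 : 0 < 1 - ‖nome τ‖ := sub_pos.mpr hq
  rw [norm_div, sin_sq_eq_nome, norm_div, norm_neg, norm_mul, norm_pow, norm_pow,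
    RCLike.norm_ofNat]
  have h5 : ‖nome τ‖ ^ (10 * k + 5) ≤ ‖nome τ‖ ^ k :=
    pow_le_pow_of_le_one (norm_nonneg _) hq.le (by omega)
  calc _ = ‖c‖ * (4 * ‖nome τ‖ ^ (10 * k + 5)) / ‖1 - nome τ ^ (10 * k + 5)‖ ^ 2 := by
        rw [← div_mul, div_mul_eq_mul_div]
    _ ≤ ‖c‖ * (4 * ‖nome τ‖ ^ k) / (1 - ‖nome τ‖) ^ 2 := by gcongr
    _ = _ := by ring

/-- The exponents are `10k + 5 ± 3` above and `10k + 5 ± 1` below; the common `(1 - q ^ (10k + 5))²`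
cancels. -/
theorem rogersFactor_eq_sin_ratio {τ : ℂ} (hq : ‖nome τ‖ < 1) (k : ℕ) {s₁ s₃ S : ℂ}
    (h₁ : s₁ ^ 2 = Complex.sin ((1 : ℕ) * (Real.pi * τ / 2)) ^ 2)
    (h₃ : s₃ ^ 2 = Complex.sin ((3 : ℕ) * (Real.pi * τ / 2)) ^ 2)
    (hS : S ^ 2 = Complex.sin ((10 * k + 5 : ℕ) * (Real.pi * τ / 2)) ^ 2) :
    (1 - s₃ ^ 2 / S ^ 2) / (1 - s₁ ^ 2 / S ^ 2) = rogersFactor (nome τ) k := by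
  rw [h₁, h₃, hS, sin_sq_eq_nome, sin_sq_eq_nome, sin_sq_eq_nome, rogersFactor]
  have hq0 := nome_ne_zero τ
  generalize nome τ = q at *
  have a5 := one_sub_pow_ne_zero hq (n := 10 * k + 5) (by omega)
  have a6 := one_sub_pow_ne_zero hq (n := 10 * k + 6) (by omega)
  have a4 := one_sub_pow_ne_zero hq (n := 10 * k + 4) (by omega)
  have hqk : q ^ (10 * k) ≠ 0 := pow_ne_zero _ hq0
  have e1 : 1 - -(1 - q ^ 1) ^ 2 / (4 * q ^ 1) /
      (-(1 - q ^ (10 * k + 5)) ^ 2 / (4 * q ^ (10 * k + 5))) =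
      (1 - q ^ (10 * k + 6)) * (1 - q ^ (10 * k + 4)) / (1 - q ^ (10 * k + 5)) ^ 2 := by
    simp only [pow_add _ (10 * k)] at *
    obtain ⟨D, hD⟩ : ∃ D, 1 - q ^ (10 * k) * q ^ 5 = D := ⟨_, rfl⟩
    rw [hD] at a5 ⊢
    field_simp
    rw [← hD]
    ring
  have e3 : 1 - -(1 - q ^ 3) ^ 2 / (4 * q ^ 3) /
      (-(1 - q ^ (10 * k + 5)) ^ 2 / (4 * q ^ (10 * k + 5))) =
      (1 - q ^ (10 * k + 8)) * (1 - q ^ (10 * k + 2)) / (1 - q ^ (10 * k + 5)) ^ 2 := by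
    simp only [pow_add _ (10 * k)] at *
    obtain ⟨D, hD⟩ : ∃ D, 1 - q ^ (10 * k) * q ^ 5 = D := ⟨_, rfl⟩
    rw [hD] at a5 ⊢
    field_simp
    rw [← hD]
    ring
  rw [e1, e3, div_div_div_cancel_right₀ (pow_ne_zero 2 a5)]

theorem exp_tsum_expansionTerm {τ : ℂ} (hq : ‖nome τ‖ < 1)
    (h : ∀ k : ℕ,
      ‖Complex.sin (Real.pi * τ / 2)‖ < ‖Complex.sin (((k : ℂ) + 1 / 2) * 5 * Real.pi * τ)‖ ∧
        ‖Complex.sin (3 * Real.pi * τ / 2)‖ <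
          ‖Complex.sin (((k : ℂ) + 1 / 2) * 5 * Real.pi * τ)‖) :
    Summable (fun x : ℕ × ℕ => expansionTerm τ (x.1 + 1) x.2) ∧
      HasProd (rogersFactor (nome τ))
        (Complex.exp (∑' x : ℕ × ℕ, expansionTerm τ (x.1 + 1) x.2)) := by
  obtain ⟨s₁, hs₁⟩ : ∃ s, s = Complex.sin (Real.pi * τ / 2) := ⟨_, rfl⟩
  obtain ⟨s₃, hs₃⟩ : ∃ s, s = Complex.sin (3 * Real.pi * τ / 2) := ⟨_, rfl⟩
  obtain ⟨S, hS⟩ : ∃ S : ℕ → ℂ, ∀ k : ℕ,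
      S k = Complex.sin (((k : ℂ) + 1 / 2) * 5 * Real.pi * τ) := ⟨_, fun _ => rfl⟩
  simp only [← hs₁, ← hs₃, ← hS] at h
  have hS' : ∀ k, S k = Complex.sin ((10 * k + 5 : ℕ) * (Real.pi * τ / 2)) := fun k => by
    rw [hS]
    congr 1
    push_cast
    ring
  have hsum : ∀ c : ℂ, Summable fun k => ‖c / S k ^ 2‖ := fun c => by
    simpa only [hS'] using summable_norm_const_div_sin_sq hq c
  have hlt : ∀ (s : ℂ) (k : ℕ), ‖s‖ < ‖S k‖ → ‖s ^ 2 / S k ^ 2‖ < 1 := fun s k hs => by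
    rw [← div_pow, norm_pow, norm_div]
    exact pow_lt_one₀ (by positivity)
      ((div_lt_one ((norm_nonneg s).trans_lt hs)).mpr hs) two_ne_zero
  have hu := fun k => hlt s₁ k (h k).1
  have hv := fun k => hlt s₃ k (h k).2
  have hterm : (fun x : ℕ × ℕ => expansionTerm τ (x.1 + 1) x.2) = fun x : ℕ × ℕ =>
      (s₁ ^ 2 / S x.2 ^ 2) ^ (x.1 + 1) / ((x.1 + 1 : ℕ) : ℂ) -
        (s₃ ^ 2 / S x.2 ^ 2) ^ (x.1 + 1) / ((x.1 + 1 : ℕ) : ℂ) := by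
    funext x
    rw [expansionTerm, ← hs₁, ← hs₃, ← hS, pow_mul, pow_mul, pow_mul, div_pow, div_pow, sub_div]
    ring
  rw [hterm]
  have hfac : (fun k => (1 - s₃ ^ 2 / S k ^ 2) / (1 - s₁ ^ 2 / S k ^ 2)) =
      rogersFactor (nome τ) := by
    funext k
    refine rogersFactor_eq_sin_ratio hq k ?_ ?_ (by rw [hS'])
    · rw [hs₁, Nat.cast_one, one_mul]
    · rw [hs₃, Nat.cast_ofNat, mul_assoc, mul_div_assoc]
  have hprod := hasProd_exp_log_expansion (hsum (s₁ ^ 2)) (hsum (s₃ ^ 2)) hu hv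
  rw [hfac] at hprod
  have hs := (summable_neg_log_expansion (hsum (s₁ ^ 2)) hu).sub
    (summable_neg_log_expansion (hsum (s₃ ^ 2)) hv)
  exact ⟨hs, hprod⟩

theorem mainTheorem4 (τ : ℂ) (hq : ‖nome τ‖ < 1) :
    -- the continued fraction converges, to `R(q)`
    Filter.Tendsto (fun n : ℕ => (rogersRamanujanFraction τ).convs n) Filter.atTop
        (nhds (rogersRamanujanR τ)) ∧
    -- the exponential expansion, on the domain of absolute convergence of the double series
    ((∀ k : ℕ,
        ‖Complex.sin (Real.pi * τ / 2)‖ <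
            ‖Complex.sin (((k : ℂ) + 1 / 2) * 5 * Real.pi * τ)‖ ∧
          ‖Complex.sin (3 * Real.pi * τ / 2)‖ <
            ‖Complex.sin (((k : ℂ) + 1 / 2) * 5 * Real.pi * τ)‖) →
      Summable (fun x : ℕ × ℕ => expansionTerm τ (x.1 + 1) x.2) ∧
      rogersRamanujanR τ =
        nomeTwoFifths τ * Complex.exp (∑' x : ℕ × ℕ, expansionTerm τ (x.1 + 1) x.2)) ∧
    -- the Rogers product formula, for all `q` with `|q| < 1`
    Multipliable (rogersFactor (nome τ)) ∧
    rogersRamanujanR τ = nomeTwoFifths τ * ∏' k : ℕ, rogersFactor (nome τ) k := by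
  have hconv := tendsto_rogersRamanujanFraction_convs τ hq
  have hprod := hasProd_rogersFactor hq (nome_ne_zero τ)
  have hR : rogersRamanujanR τ = nomeTwoFifths τ *
      (rogersSelbergSeries (nome τ) 1 / rogersSelbergSeries (nome τ) 0) := hconv.limUnder_eq
  refine ⟨hR ▸ hconv, fun h => ?_, hprod.multipliable, by rw [hR, hprod.tprod_eq]⟩
  obtain ⟨hs, hexp⟩ := exp_tsum_expansionTerm hq h
  -- The exponential and `F 1 / F 0` are values of the same convergent product.
  exact ⟨hs, by rw [hR, hexp.unique hprod]⟩
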